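/- **Setting.** Let $d\ge 1$. Fix a smooth orthonormal dyadic wavelet basis $(\psi_\lambda)_{\lambda\in\Lambda}$ of $L_2(\mathbb R^d)$ (for example the Meyer basis): it consists of the integer translates of a Schwartz function (level $|\lambda|=0$) and of $2^{jd/2}\psi_e(2^jx-k)$, $j\ge 0$, $k\in\mathbb Z^d$, $1\le e\le 2^d-1$ (level $|\lambda|=j$), where the $\psi_e$ are Schwartz functions all of whose polynomial moments vanish. All functions and distributions are real-valued. For a tempered distribution $u$ put $u_\lambda=\langle u,\psi_\lambda\rangle$ and, for $s\in\mathbb R$, $p>0$, $$\|u\|_{B^s_p}=\Big(\sum_{\lambda\in\Lambda}2^{p(s+d(\frac12-\frac1p))|\lambda|}\,|u_\lambda|^p\Big)^{1/p}\in[0,\infty],\qquad B^s_p=\{u:\|u\|_{B^s_p}<\infty\},\qquad H^s=B^s_2 .$$ Write $p^*=p/(p-1)$ (with $p_G/p_G^*=p_G-1$ in general, in particular $=0$ for $p_G=1$). Let $\mathcal B_D=B^{s_D}_{p_D}$ with $p_D>1$, and $\mathcal B_S=B^{s_S}_{p_S}$, $\mathcal B_G=B^{s_G}_{p_G}$ with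 $p_S,p_G>0$. Assume $\mathcal B_S\subset\mathcal B_D$ in the sense $$p_S\le p_D,\qquad s_S-\tfrac d{p_S}>s_D-\tfrac d{p_D},$$ assume $\mathcal B_G\subset\mathcal B_D^*=B^{-s_D}_{p_D^*}$ in the sense $$\tfrac1{p_G}\ge\tfrac1{p_D^*},\qquad s_G-\tfrac d{p_G}\ge -s_D-\tfrac d{p_D^*},$$ and assume $p_S\le p_G$. Let $F:\mathcal B_D\to L_2(\mathbb R^d)$ be linear and continuous with $\mathcal B_G\subset\operatorname{rg}F^*$ (in particular, $\operatorname{rg}F^*=\mathcal B_G$ is allowed). Here $g\in\operatorname{rg}F^*$ means that for some $w\in L_2$ one has $\langle w,Fu\rangle=\sum_\lambda g_\lambda u_\lambda$ for all $u\in\mathcal B_D$. For $\varepsilon>0$ the *allowed penalties* are the functionals $\|\cdot\|_{B^{s_R}_{p_R}}^{p_R}$ such that for some $p>0$ with $p_S\le p\le\min\{p_D,p_G\}$ $$p_R=\frac{p+p_G}{p_G},\qquad s_R\le\frac{p\,s_S-p_Gs_G}{p+p_G}-d\,\frac1{p+p_G}\Big(\frac p{p_S}-1\Big)-\varepsilon\Big(\frac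 p{p_S}-1\Big),\tag{1}$$ and the exponent of such a penalty is $\sigma=s_R+d\big(\tfrac12-\tfrac1{p_R}\big)$. For $y\in L_2$ and $\alpha>0$ let $T_\alpha(u)=\|Fu-y\|_{L_2}^2+\alpha\|u\|_{B^{s_R}_{p_R}}^{p_R}$ for $u\in\mathcal B_D$, with values in $[0,\infty]$. For $u^\dagger\in\mathcal B_D$ we say that the penalty gives *the rate in $H^\tau$* if for all $a,b>0$ there are $K,\delta_0>0$ such that for all $0<\delta<\delta_0$, all $\alpha\in[a\delta,b\delta]$, all $y=v^\delta\in L_2$ with $\|Fu^\dagger-v^\delta\|_{L_2}\le\delta$ and every minimizer $u^{\alpha,\delta}$ of $T_\alpha$ over $\mathcal B_D$ $$\|u^{\alpha,\delta}-u^\dagger\|_{H^\tau}\le K\sqrt\delta .$$ **Statement.** Let $p=\min\{p_D,p_G\}$, and let the *optimal penalty* be the one with this $p$ and with equality in (1); write $\sigma_\varepsilon(\mathcal B_S)$ for its exponent $\sigma$, and also use this formula for $\varepsilon=0$. 1. There is $\varepsilon_0>0$, depending only on $d$ and the indices of $\mathcal B_D,\mathcal B_S,\mathcal B_G$, such that for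 all $0<\varepsilon<\varepsilon_0$ the optimal penalty is allowed and is the unique allowed penalty with the largest $\sigma$. Moreover, $\|u\|_{H^\sigma}\le\|u\|_{H^{\sigma_\varepsilon(\mathcal B_S)}}$ for every tempered distribution $u$ and the exponent $\sigma$ of every allowed penalty, so that the optimal penalty gives the strongest rate. 2. Let $p_G\ge p_D$, $\varepsilon>0$ and $\tilde\varepsilon=\varepsilon\big(\frac{p_D}{p_S}-1\big)$. Then the optimal penalty has $$p_R=\frac{p_D+p_G}{p_G},\qquad s_R=\frac{p_Ds_S-p_Gs_G}{p_D+p_G}-d\,\frac1{p_D+p_G}\Big(\frac{p_D}{p_S}-1\Big)-\tilde\varepsilon,$$ and for every $u^\dagger\in\mathcal B_S$ it gives the rate in $H^\sigma$ with $$\sigma=\frac{p_Ds_S-p_Gs_G}{p_D+p_G}+d\Big[\frac12-\frac1{p_D+p_G}\Big(\frac{p_G}{p_G^*}+\frac{p_D}{p_S}\Big)\Big]-\tilde\varepsilon=\sigma_\varepsilon(\mathcal B_S).$$ 3. Let $p_G<p_D$, $\varepsilon>0$ and $\tilde\varepsilon=\varepsilon\big(\frac{p_G}{p_S}-1\big)$.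 Then the optimal penalty has $$p_R=2,\qquad s_R=\tfrac12\Big(s_S-\frac d{p_S}-\Big(s_G-\frac d{p_G}\Big)\Big)-\tilde\varepsilon=\sigma_\varepsilon(\mathcal B_S),$$ and for every $u^\dagger\in\mathcal B_S$ it gives the rate in $B^{s_R}_{p_R}=H^{s_R}$. 4. Let $\mathcal B_T=B^{s_T}_{p_T}\subset\mathcal B_S$ be a tighter source condition, that is, $0<p_T\le p_S$ and $s_T-\frac d{p_T}>s_S-\frac d{p_S}$. Then, neglecting $\varepsilon$, $$\sigma_0(\mathcal B_T)-\sigma_0(\mathcal B_S)=c\,\Big(s_T-\frac d{p_T}-\Big(s_S-\frac d{p_S}\Big)\Big)>0,\qquad c=\frac{p_D}{p_D+p_G}\ \text{ if }p_G\ge p_D,\quad c=\tfrac12\ \text{ if }p_G<p_D,$$ and $\sigma_\varepsilon(\mathcal B_T)>\sigma_\varepsilon(\mathcal B_S)$ for all sufficiently small $\varepsilon>0$. -/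

import Mathlib

open MeasureTheory
open scoped ENNReal SchwartzMap

noncomputable section

namespace BesovTikhonov

/-- Euclidean space `ℝ^d`. -/
abbrev Space (d : ℕ) : Type := EuclideanSpace ℝ (Fin d)

/-- Real tempered distributions on `ℝ^d`. -/
abbrev Distr (d : ℕ) : Type := 𝓢(Space d, ℝ) →L[ℝ] ℝ

/-- The indices `λ ∈ Λ` of an inhomogeneous dyadic wavelet basis of `L₂(ℝ^d)`: the integer
translates of the scaling function, and the wavelets of level `j ≥ 0`, type `e` (there are
`2 ^ d - 1` types) and position `k ∈ ℤ^d`. -/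
inductive WaveletIndex (d : ℕ) : Type
  | scaling (k : Fin d → ℤ) : WaveletIndex d
  | detail (j : ℕ) (e : Fin (2 ^ d - 1)) (k : Fin d → ℤ) : WaveletIndex d

/-- The level `|λ|`. -/
def WaveletIndex.level {d : ℕ} : WaveletIndex d → ℕ
  | .scaling _ => 0
  | .detail j _ _ => j

/-- The lattice point `k ∈ ℤ^d` as an element of `ℝ^d`. -/
def latticePoint {d : ℕ} (k : Fin d → ℤ) : Space d := WithLp.toLp 2 (fun i => (k i : ℝ))

/-- `x ↦ 2 ^ (j d / 2) f (2 ^ j x - k)`. -/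
def dilateTranslate {d : ℕ} (f : 𝓢(Space d, ℝ)) (j : ℕ) (k : Fin d → ℤ) : 𝓢(Space d, ℝ) :=
  (2 : ℝ) ^ ((j : ℝ) * d / 2) •
    SchwartzMap.compCLMOfContinuousLinearEquiv ℝ
      (ContinuousLinearEquiv.smulLeft (R₁ := ℝ) (M₁ := Space d)
        (Units.mk0 ((2 : ℝ) ^ j) (pow_ne_zero j two_ne_zero)))
      (SchwartzMap.compSubConstCLM ℝ (latticePoint k) f)

theorem dilateTranslate_apply {d : ℕ} (f : 𝓢(Space d, ℝ)) (j : ℕ) (k : Fin d → ℤ) (x : Space d) :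
    dilateTranslate f j k x =
      (2 : ℝ) ^ ((j : ℝ) * d / 2) * f ((2 : ℝ) ^ j • x - latticePoint k) := rfl

/-- The function `ψ_λ` with index `λ` generated by a scaling function `φ` and wavelets `ψ e`. -/
def waveletAtom {d : ℕ} (φ : 𝓢(Space d, ℝ)) (ψ : Fin (2 ^ d - 1) → 𝓢(Space d, ℝ)) :
    WaveletIndex d → 𝓢(Space d, ℝ)
  | .scaling k => dilateTranslate φ 0 k
  | .detail j e k => dilateTranslate (ψ e) j k

/-- A smooth orthonormal dyadic wavelet basis of `L₂(ℝ^d)` (for instance the Meyer basis): the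
generators are Schwartz functions, all polynomial moments of the wavelets vanish, and the functions
`ψ_λ` form a complete orthonormal system. -/
structure WaveletBasis (d : ℕ) where
  φ : 𝓢(Space d, ℝ)
  ψ : Fin (2 ^ d - 1) → 𝓢(Space d, ℝ)
  moments : ∀ (e : Fin (2 ^ d - 1)) (m : ℕ)
    (L : ContinuousMultilinearMap ℝ (fun _ : Fin m => Space d) ℝ),
    ∫ x : Space d, L (fun _ => x) * ψ e x = 0
  normalized : ∀ i : WaveletIndex d, ∫ x : Space d, waveletAtom φ ψ i x * waveletAtom φ ψ i x = 1
  orthogonal : ∀ i i' : WaveletIndex d, i ≠ i' →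
    ∫ x : Space d, waveletAtom φ ψ i x * waveletAtom φ ψ i' x = 0
  complete : ∀ f : Space d → ℝ, MemLp f 2 volume →
    (∀ i : WaveletIndex d, ∫ x : Space d, f x * waveletAtom φ ψ i x = 0) → f =ᵐ[volume] 0

/-- The wavelet coefficient `u_λ = ⟨u, ψ_λ⟩` of a tempered distribution `u`. -/
def WaveletBasis.coeff {d : ℕ} (W : WaveletBasis d) (u : Distr d) (i : WaveletIndex d) : ℝ :=
  u (waveletAtom W.φ W.ψ i)

/-- The norm of the Besov space `B^s_p = B^s_{p,p}(ℝ^d)`, through wavelet coefficients,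
`(∑_λ 2 ^ (p (s + d (1/2 - 1/p)) |λ|) |u_λ| ^ p) ^ (1/p)`; it is `∞` outside the space.
For `p = 2` it is the norm of the Sobolev space `H^s`. -/
def besovNorm {d : ℕ} (W : WaveletBasis d) (s p : ℝ) (u : Distr d) : ℝ≥0∞ :=
  (∑' i : WaveletIndex d, ENNReal.ofReal
    ((2 : ℝ) ^ (p * (s + d * (1 / 2 - 1 / p)) * (i.level : ℝ)) * |W.coeff u i| ^ p)) ^ (1 / p)

theorem besovNorm_lt_top {d : ℕ} (W : WaveletBasis d) (s p : ℝ) (hp : 0 < p) (u : Distr d) :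
    besovNorm W s p u < ⊤ ↔ (∑' i : WaveletIndex d, ENNReal.ofReal
      ((2 : ℝ) ^ (p * (s + d * (1 / 2 - 1 / p)) * (i.level : ℝ)) * |W.coeff u i| ^ p)) < ⊤ := by
  unfold besovNorm
  rw [ENNReal.rpow_lt_top_iff_of_pos (by positivity)]

/-- The Besov space `B^s_p`, a subspace of the tempered distributions. -/
def besovSpace {d : ℕ} (W : WaveletBasis d) (s p : ℝ) (hp : 0 < p) : Submodule ℝ (Distr d) where
  carrier := {u | besovNorm W s p u < ⊤}
  zero_mem' := by
    rw [Set.mem_ofPred_eq, besovNorm_lt_top W s p hp]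
    simp [WaveletBasis.coeff, Real.zero_rpow hp.ne']
  add_mem' := by
    intro u v hu hv
    rw [Set.mem_ofPred_eq, besovNorm_lt_top W s p hp] at hu hv ⊢
    have key : ∀ a b : ℝ, |a + b| ^ p ≤ 2 ^ p * (|a| ^ p + |b| ^ p) := by
      intro a b
      have hm : |a + b| ≤ 2 * max |a| |b| := by
        have h1 := abs_add_le a b
        have h2 := le_max_left |a| |b|
        have h3 := le_max_right |a| |b|
        linarith
      calc |a + b| ^ p ≤ (2 * max |a| |b|) ^ p := Real.rpow_le_rpow (abs_nonneg _) hm hp.le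
        _ = 2 ^ p * (max |a| |b|) ^ p := Real.mul_rpow (by norm_num) (by positivity)
        _ ≤ 2 ^ p * (|a| ^ p + |b| ^ p) := by
          gcongr
          have ha : 0 ≤ |a| ^ p := by positivity
          have hb : 0 ≤ |b| ^ p := by positivity
          rcases max_choice |a| |b| with h | h <;> rw [h] <;> linarith
    refine lt_of_le_of_lt (ENNReal.tsum_le_tsum (g := fun i : WaveletIndex d =>
      ENNReal.ofReal (2 ^ p) * (ENNReal.ofReal
        ((2 : ℝ) ^ (p * (s + d * (1 / 2 - 1 / p)) * (i.level : ℝ)) * |W.coeff u i| ^ p) +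
        ENNReal.ofReal
        ((2 : ℝ) ^ (p * (s + d * (1 / 2 - 1 / p)) * (i.level : ℝ)) * |W.coeff v i| ^ p)))
      fun i => ?_) ?_
    · rw [← ENNReal.ofReal_add (by positivity) (by positivity),
        ← ENNReal.ofReal_mul (by positivity)]
      apply ENNReal.ofReal_le_ofReal
      have h := key (W.coeff u i) (W.coeff v i)
      have hc : W.coeff (u + v) i = W.coeff u i + W.coeff v i := rfl
      rw [hc]
      calc _ ≤ (2 : ℝ) ^ (p * (s + d * (1 / 2 - 1 / p)) * (i.level : ℝ)) *
            (2 ^ p * (|W.coeff u i| ^ p + |W.coeff v i| ^ p)) := by gcongr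
        _ = _ := by ring
    · rw [ENNReal.tsum_mul_left, ENNReal.tsum_add]
      exact ENNReal.mul_lt_top ENNReal.ofReal_lt_top (ENNReal.add_lt_top.2 ⟨hu, hv⟩)
  smul_mem' := by
    intro c u hu
    rw [Set.mem_ofPred_eq, besovNorm_lt_top W s p hp] at hu ⊢
    have h : ∀ i : WaveletIndex d, ENNReal.ofReal
        ((2 : ℝ) ^ (p * (s + d * (1 / 2 - 1 / p)) * (i.level : ℝ)) * |W.coeff (c • u) i| ^ p) =
        ENNReal.ofReal (|c| ^ p) * ENNReal.ofReal
        ((2 : ℝ) ^ (p * (s + d * (1 / 2 - 1 / p)) * (i.level : ℝ)) * |W.coeff u i| ^ p) := by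
      intro i
      have hc : W.coeff (c • u) i = c * W.coeff u i := rfl
      rw [hc, abs_mul, Real.mul_rpow (abs_nonneg _) (abs_nonneg _),
        ← ENNReal.ofReal_mul (by positivity)]
      congr 1
      ring
    rw [tsum_congr h, ENNReal.tsum_mul_left]
    exact ENNReal.mul_lt_top ENNReal.ofReal_lt_top hu

/-- The data space `L₂(ℝ^d)`. -/
abbrev L2 (d : ℕ) : Type := Lp ℝ 2 (volume : Measure (Space d))

section Operator

variable {d : ℕ} {W : WaveletBasis d} {sD pD : ℝ} {hD : 0 < pD}

/-- Continuity of a linear operator `B_D → L₂`. -/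
def IsBounded (F : besovSpace W sD pD hD →ₗ[ℝ] L2 d) : Prop :=
  ∃ C : ℝ, 0 ≤ C ∧ ∀ u : besovSpace W sD pD hD,
    ENNReal.ofReal ‖F u‖ ≤ ENNReal.ofReal C * besovNorm W sD pD (u : Distr d)

/-- `rg F* ⊆ B_D*` as a set of distributions: `g` belongs to it if for some `w ∈ L₂` the functional
`F* w : u ↦ ⟨w, F u⟩` on `B_D` is the duality pairing `u ↦ ∑_λ g_λ u_λ` with `g`. -/
def adjointRange (F : besovSpace W sD pD hD →ₗ[ℝ] L2 d) : Set (Distr d) :=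
  {g | ∃ w : L2 d, ∀ u : besovSpace W sD pD hD,
    HasSum (fun i => W.coeff g i * W.coeff (u : Distr d) i) (inner ℝ w (F u))}

/-- The Tikhonov functional `T_α(u) = ‖F u - y‖² + α ‖u‖_{B_R} ^ p_R`, with values in `[0, ∞]`. -/
def tikhonov (F : besovSpace W sD pD hD →ₗ[ℝ] L2 d) (sR pR α : ℝ) (y : L2 d)
    (u : besovSpace W sD pD hD) : ℝ≥0∞ :=
  ENNReal.ofReal (‖F u - y‖ ^ 2) + ENNReal.ofReal α * besovNorm W sR pR (u : Distr d) ^ pR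

/-- `u ∈ argmin T_α` over `B_D`. -/
def IsTikhonovMinimizer (F : besovSpace W sD pD hD →ₗ[ℝ] L2 d) (sR pR α : ℝ) (y : L2 d)
    (u : besovSpace W sD pD hD) : Prop :=
  ∀ u' : besovSpace W sD pD hD, tikhonov F sR pR α y u ≤ tikhonov F sR pR α y u'

/-- The convergence rate `‖u^{α,δ} - u†‖_{H^σ} = O(√δ)` as `δ → 0`, for every minimizer
`u^{α,δ}` of the Tikhonov functional with the penalty `‖·‖_{B_R} ^ p_R`, exact data `F u†`, noisy
data of noise level `δ`, and the parameter rule `α ≍ δ`, that is `a δ ≤ α ≤ b δ`. -/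
def ConvergenceRate (F : besovSpace W sD pD hD →ₗ[ℝ] L2 d) (uDag : besovSpace W sD pD hD)
    (sR pR σ : ℝ) : Prop :=
  ∀ a b : ℝ, 0 < a → 0 < b → ∃ K δ₀ : ℝ, 0 < K ∧ 0 < δ₀ ∧
    ∀ δ : ℝ, 0 < δ → δ < δ₀ → ∀ α : ℝ, a * δ ≤ α → α ≤ b * δ →
      ∀ y : L2 d, ‖F uDag - y‖ ≤ δ →
        ∀ u : besovSpace W sD pD hD, IsTikhonovMinimizer F sR pR α y u →
          besovNorm W σ 2 ((u : Distr d) - (uDag : Distr d)) ≤ ENNReal.ofReal (K * √δ)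

end Operator

/-- The bound on the smoothness `s_R` of the penalty for the parameter `p`. -/
def smoothnessBound (d : ℕ) (sS pS sG pG ε p : ℝ) : ℝ :=
  (p * sS - pG * sG) / (p + pG) - d * (1 / (p + pG) * (p / pS - 1)) - ε * (p / pS - 1)

/-- The penalties `‖·‖_{B_R} ^ p_R` allowed by the weakened source conditions. -/
def AllowedPenalty (d : ℕ) (sS pS pD sG pG ε sR pR : ℝ) : Prop :=
  ∃ p : ℝ, 0 < p ∧ pS ≤ p ∧ p ≤ min pD pG ∧
    pR = (p + pG) / pG ∧ sR ≤ smoothnessBound d sS pS sG pG ε p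

/-- The exponent `σ = s_R + d (1/2 - 1/p_R)` of the Sobolev space of the convergence rate. -/
def rateExponent (d : ℕ) (sR pR : ℝ) : ℝ := sR + d * (1 / 2 - 1 / pR)

/-- `p_R` for the choice `p = min {p_D, p_G}`. -/
def optP (pD pG : ℝ) : ℝ := (min pD pG + pG) / pG

/-- `s_R` for the choice `p = min {p_D, p_G}`. -/
def optS (d : ℕ) (sS pS pD sG pG ε : ℝ) : ℝ := smoothnessBound d sS pS sG pG ε (min pD pG)

/-- `σ` for the choice `p = min {p_D, p_G}`, as a function of the source space `B^{s_S}_{p_S}`. -/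
def optRate (d : ℕ) (pD sG pG ε sS pS : ℝ) : ℝ :=
  rateExponent d (optS d sS pS pD sG pG ε) (optP pD pG)

end BesovTikhonov

end

noncomputable section

namespace BesovTikhonov

/-! In wavelet coordinates `B^s_p` is an `ℓ^p` space with weight `2 ^ (τ|λ|)`, `τ = s + d(1/2 -
1/p)`. With `τ = σ` taken from the penalty and `x_λ = 2 ^ (σ|λ|) u†_λ`, the subgradient of the
penalty at `u†` has coefficients of size `p_R 2 ^ (σ|λ|) |x_λ| ^ (p_R - 1)`. As `(p_R - 1) p_G = p`,
membership of this sequence in `B_G` is a weighted `ℓ^p` condition on `u†`, and the bound on `s_R`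
makes it follow from `u† ∈ B_S`. So the subgradient lies in `B_G ⊆ rg F*`, the classical source
condition (`convergenceRate_of_mem`). That it is a tempered distribution at all rests on the decay
of wavelet coefficients of Schwartz functions (`WaveletBasis.exists_coeff_eq`).

The source condition and `α ≍ δ` give a Bregman distance of order `δ` (`bregman_le`). Since `1 < p_R
≤ 2`, `|t| ^ p_R` is strongly convex on bounded sets (`mul_sub_sq_le_abs_rpow`), so this distance
dominates the squared `ℓ²` distance of the weighted coefficients, which is the squared `H^σ` norm.

As a function of `p` the exponent is `(pA - p_G B)/(p + p_G)` minus a small `ε`-term. The two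
embeddings give `A + B > 0`, hence monotonicity, and the largest `p` wins. -/

/-! ### Summable weights on the lattice and on the wavelet indices. -/

theorem one_add_norm_latticePoint_pow_inv_le {d : ℕ} (k : Fin d → ℤ) :
    ((1 + ‖latticePoint k‖) ^ (2 * d))⁻¹ ≤ ∏ i, ((1 + |(k i : ℝ)|) ^ 2)⁻¹ := by
  rw [Finset.prod_inv_distrib]
  refine inv_anti₀ (Finset.prod_pos fun i _ => by positivity) ?_
  calc ∏ i, (1 + |(k i : ℝ)|) ^ 2 ≤ ∏ _i : Fin d, (1 + ‖latticePoint k‖) ^ 2 := by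
        refine Finset.prod_le_prod (fun i _ => by positivity) fun i _ => ?_
        have h : ‖(latticePoint k) i‖ ≤ ‖latticePoint k‖ := PiLp.norm_apply_le _ i
        have h' : |(k i : ℝ)| ≤ ‖latticePoint k‖ := h
        gcongr
    _ = _ := by simp [pow_mul]

/-- A finite set of lattice points sits in the box spanned by its projections, where the sum of
products is a product of sums. -/
theorem summable_pi_prod {d : ℕ} {g : ℤ → ℝ} (hg : ∀ n, 0 ≤ g n) (hs : Summable g) :
    Summable fun k : Fin d → ℤ => ∏ i, g (k i) := by
  refine summable_of_sum_le (c := ∏ _i : Fin d, ∑' n, g n)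
    (fun k => Finset.prod_nonneg fun i _ => hg _) fun s => ?_
  calc ∑ k ∈ s, ∏ i, g (k i)
      ≤ ∑ k ∈ Fintype.piFinset (fun i => s.image (fun k => k i)), ∏ i, g (k i) := by
        refine Finset.sum_le_sum_of_subset_of_nonneg (fun k hk => ?_)
          fun k _ _ => Finset.prod_nonneg fun i _ => hg _
        exact Fintype.mem_piFinset.2 fun i => Finset.mem_image_of_mem _ hk
    _ = ∏ i, ∑ n ∈ s.image (fun k : Fin d → ℤ => k i), g n := (Finset.prod_univ_sum _ _).symm
    _ ≤ _ := Finset.prod_le_prod (fun i _ => Finset.sum_nonneg fun n _ => hg n)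
        fun i _ => hs.sum_le_tsum _ fun n _ => hg n

theorem summable_lattice (d : ℕ) :
    Summable fun k : Fin d → ℤ => ((1 + ‖latticePoint k‖) ^ (2 * d))⁻¹ := by
  have h1 : Summable fun n : ℕ => ((1 + |(n : ℝ)|) ^ 2)⁻¹ := by
    refine ((summable_nat_add_iff 1).2 (Real.summable_nat_pow_inv.2 one_lt_two)).congr fun n => ?_
    push_cast
    rw [abs_of_nonneg (by positivity : (0 : ℝ) ≤ n), add_comm]
  have h2 : Summable fun n : ℤ => ((1 + |(n : ℝ)|) ^ 2)⁻¹ := by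
    refine summable_int_iff_summable_nat_and_neg.2 ⟨?_, ?_⟩ <;> simpa using h1
  exact Summable.of_nonneg_of_le (fun k => by positivity) one_add_norm_latticePoint_pow_inv_le
    (summable_pi_prod (g := fun n : ℤ => ((1 + |(n : ℝ)|) ^ 2)⁻¹) (fun n => by positivity) h2)

/-- A summable weight on the wavelet indices. -/
def WaveletIndex.decay {d : ℕ} : WaveletIndex d → ℝ
  | .scaling k => ((1 + ‖latticePoint k‖) ^ (2 * d))⁻¹
  | .detail j _ k => (1 / 2) ^ j * ((1 + ‖latticePoint k‖) ^ (2 * d))⁻¹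

/-- The indices as a disjoint union of products. -/
def WaveletIndex.sumEquiv (d : ℕ) :
    (Fin d → ℤ) ⊕ ((ℕ × Fin (2 ^ d - 1)) × (Fin d → ℤ)) ≃ WaveletIndex d where
  toFun
    | .inl k => .scaling k
    | .inr x => .detail x.1.1 x.1.2 x.2
  invFun
    | .scaling k => .inl k
    | .detail j e k => .inr ((j, e), k)
  left_inv := by rintro (k | ⟨⟨j, e⟩, k⟩) <;> rfl
  right_inv := by rintro (k | ⟨j, e, k⟩) <;> rfl

theorem summable_decay (d : ℕ) : Summable (WaveletIndex.decay (d := d)) := by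
  rw [← (WaveletIndex.sumEquiv d).summable_iff]
  refine Summable.sum _ (summable_lattice d) ?_
  have h1 : Summable fun x : ℕ × Fin (2 ^ d - 1) => ((1 : ℝ) / 2) ^ x.1 * 1 :=
    summable_geometric_two.mul_of_nonneg
      (Summable.of_finite : Summable fun _ : Fin (2 ^ d - 1) => (1 : ℝ))
      (fun j => by positivity) fun _ => zero_le_one
  have h2 := h1.mul_of_nonneg (summable_lattice d) (fun j => by positivity) fun k => by positivity
  refine h2.congr fun x => ?_
  simp [WaveletIndex.sumEquiv, WaveletIndex.decay]

/-! ### Decay of the wavelet coefficients of Schwartz functions. -/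

/-- A Schwartz seminorm controlling `(1 + ‖x‖) ^ M ‖D ^ m f‖` for `m ≤ N`. -/
def schwartzSup {d : ℕ} (M N : ℕ) (f : 𝓢(Space d, ℝ)) : ℝ :=
  2 ^ M * (Finset.Iic (M, N)).sup (schwartzSeminormFamily ℝ (Space d) ℝ) f

theorem schwartzSup_nonneg {d : ℕ} (M N : ℕ) (f : 𝓢(Space d, ℝ)) : 0 ≤ schwartzSup M N f :=
  mul_nonneg (by positivity) (apply_nonneg _ _)

theorem norm_iteratedFDeriv_le_schwartzSup {d : ℕ} {M N m : ℕ} (hm : m ≤ N) (f : 𝓢(Space d, ℝ))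
    (x : Space d) :
    ‖iteratedFDeriv ℝ m f x‖ ≤ schwartzSup M N f * ((1 + ‖x‖) ^ M)⁻¹ := by
  rw [← div_eq_mul_inv, le_div_iff₀ (by positivity), mul_comm]
  exact SchwartzMap.one_add_le_sup_seminorm_apply (𝕜 := ℝ) (m := (M, N)) le_rfl hm f x

theorem inv_one_add_norm_add_le {E : Type*} [NormedAddCommGroup E] (x z : E) (M : ℕ) :
    ((1 + ‖x + z‖) ^ M)⁻¹ ≤ (1 + ‖z‖) ^ M * ((1 + ‖x‖) ^ M)⁻¹ := by
  rw [← div_eq_mul_inv, le_div_iff₀ (by positivity), inv_mul_le_iff₀ (by positivity), ← mul_pow]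
  refine pow_le_pow_left₀ (by positivity) ?_ M
  have h : ‖x‖ ≤ ‖x + z‖ + ‖z‖ := by simpa using norm_sub_le (x + z) z
  nlinarith [norm_nonneg (x + z), norm_nonneg z, mul_nonneg (norm_nonneg (x + z)) (norm_nonneg z)]

/-- Taylor's theorem with a bound on the remainder. -/
theorem abs_sub_taylor_le {E : Type*} [NormedAddCommGroup E] [NormedSpace ℝ E] {f : E → ℝ} {n : ℕ}
    (hf : ContDiff ℝ (n + 1) f) (x y : E) {B : ℝ}
    (hB : ∀ t ∈ Set.Icc (0 : ℝ) 1, ‖iteratedFDeriv ℝ (n + 1) f (x + t • y)‖ ≤ B) :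
    |f (x + y) - ∑ m ∈ Finset.range (n + 1),
      (m.factorial : ℝ)⁻¹ * iteratedFDeriv ℝ m f x (fun _ => y)| ≤ B * ‖y‖ ^ (n + 1) := by
  have h := map_add_eq_sum_add_integral_iteratedFDeriv (f := f) (x := x) (y := y) (n := n)
    fun t _ => hf.contDiffAt
  simp only [smul_eq_mul] at h
  have hB0 : 0 ≤ B := (norm_nonneg _).trans (hB 0 (by simp))
  rw [h, add_sub_cancel_left, abs_mul]
  have h1 : |∫ t in (0 : ℝ)..1,
      (1 - t) ^ n * iteratedFDeriv ℝ (n + 1) f (x + t • y) (fun _ => y)| ≤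
      B * ‖y‖ ^ (n + 1) := by
    have := intervalIntegral.norm_integral_le_of_norm_le_const (a := (0 : ℝ)) (b := 1)
      (C := B * ‖y‖ ^ (n + 1))
      (f := fun t => (1 - t) ^ n * iteratedFDeriv ℝ (n + 1) f (x + t • y) (fun _ => y)) ?_
    · simpa using this
    · intro t ht
      rw [Set.uIoc_of_le zero_le_one] at ht
      rw [norm_mul]
      have h2 : ‖(1 - t) ^ n‖ ≤ 1 := by
        rw [norm_pow]
        refine pow_le_one₀ (norm_nonneg _) ?_
        rw [Real.norm_eq_abs, abs_le]
        constructor <;> linarith [ht.1, ht.2]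
      have h3 : ‖iteratedFDeriv ℝ (n + 1) f (x + t • y) (fun _ => y)‖ ≤ B * ‖y‖ ^ (n + 1) := by
        refine (ContinuousMultilinearMap.le_opNorm _ _).trans ?_
        simp only [Finset.prod_const, Finset.card_univ, Fintype.card_fin]
        gcongr
        exact hB t ⟨ht.1.le, ht.2⟩
      calc _ ≤ 1 * (B * ‖y‖ ^ (n + 1)) := by gcongr
        _ = _ := one_mul _
  have h4 : |((n.factorial : ℝ))⁻¹| ≤ 1 := by
    rw [abs_of_nonneg (by positivity)]
    exact inv_le_one_of_one_le₀ (by exact_mod_cast n.factorial_pos)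
  calc _ ≤ 1 * (B * ‖y‖ ^ (n + 1)) := by gcongr
    _ = _ := one_mul _

theorem integral_mul_dilateTranslate {d : ℕ} (f : Space d → ℝ) (η : 𝓢(Space d, ℝ)) (j : ℕ)
    (k : Fin d → ℤ) :
    ∫ x, f x * dilateTranslate η j k x =
      (2 : ℝ) ^ ((j : ℝ) * d / 2) * (((2 : ℝ) ^ j) ^ d)⁻¹ *
        ∫ y, f (((2 : ℝ) ^ j)⁻¹ • latticePoint k + ((2 : ℝ) ^ j)⁻¹ • y) * η y := by
  have h2 : (2 : ℝ) ^ j ≠ 0 := by positivity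
  have h := Measure.integral_comp_smul (volume : Measure (Space d))
    (fun z => f (((2 : ℝ) ^ j)⁻¹ • z) * η (z - latticePoint k)) ((2 : ℝ) ^ j)
  have h' := integral_add_right_eq_self (μ := (volume : Measure (Space d)))
    (fun z => f (((2 : ℝ) ^ j)⁻¹ • z) * η (z - latticePoint k)) (latticePoint k)
  simp only [smul_smul, inv_mul_cancel₀ h2, one_smul, finrank_euclideanSpace, Fintype.card_fin,
    smul_eq_mul] at h
  simp only [add_sub_cancel_right] at h'
  rw [abs_of_nonneg (by positivity), ← h'] at h
  simp only [dilateTranslate_apply]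
  calc _ = (2 : ℝ) ^ ((j : ℝ) * d / 2) *
        ∫ x, f x * η ((2 : ℝ) ^ j • x - latticePoint k) := by
        rw [← integral_const_mul]; congr 1; ext x; ring
    _ = _ := by
        rw [h, mul_assoc]; congr 3; ext y; rw [← smul_add, add_comm]

/-- The normalization `2 ^ (jd/2)` times the Jacobian `2 ^ (-jd)` is at most `1`. Discarding it is
harmless, since vanishing moments yield any power of the scale. -/
theorem abs_integral_mul_dilateTranslate_le {d : ℕ} (f : Space d → ℝ) (η : 𝓢(Space d, ℝ)) (j : ℕ)
    (k : Fin d → ℤ) :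
    |∫ x, f x * dilateTranslate η j k x| ≤
        |∫ y, f (((2 : ℝ) ^ j)⁻¹ • latticePoint k + ((2 : ℝ) ^ j)⁻¹ • y) * η y| := by
  rw [integral_mul_dilateTranslate, abs_mul]
  refine mul_le_of_le_one_left (abs_nonneg _) ?_
  rw [abs_of_nonneg (by positivity), ← div_eq_mul_inv, div_le_one (by positivity),
    ← pow_mul, ← Real.rpow_natCast]
  refine Real.rpow_le_rpow_of_exponent_le one_le_two ?_
  push_cast
  nlinarith [(by positivity : (0 : ℝ) ≤ (j : ℝ) * d)]

theorem integrable_one_add_norm_pow_mul {d : ℕ} (η : 𝓢(Space d, ℝ)) (m : ℕ) :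
    Integrable fun y => (1 + ‖y‖) ^ m * |η y| := by
  have h1 := (η.integrable_pow_mul volume 0).add (η.integrable_pow_mul volume m)
  refine (h1.const_mul (2 ^ (m - 1))).mono' (by fun_prop) (Filter.Eventually.of_forall fun y => ?_)
  rw [Real.norm_eq_abs, abs_of_nonneg (by positivity)]
  calc (1 + ‖y‖) ^ m * |η y| ≤ (2 ^ (m - 1) * (1 ^ m + ‖y‖ ^ m)) * |η y| := by
        gcongr; exact add_pow_le zero_le_one (norm_nonneg _) m
    _ = _ := by simp; ring

/-- Decay of the coefficients of Schwartz functions with respect to integer translates. -/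
theorem abs_integral_mul_translate_le {d : ℕ} (η : 𝓢(Space d, ℝ)) (M N : ℕ) (f : 𝓢(Space d, ℝ))
    (k : Fin d → ℤ) :
    |∫ x, f x * dilateTranslate η 0 k x| ≤
      (∫ y, (1 + ‖y‖) ^ M * |η y|) * schwartzSup M N f * ((1 + ‖latticePoint k‖) ^ M)⁻¹ := by
  refine (abs_integral_mul_dilateTranslate_le f η 0 k).trans ?_
  simp only [pow_zero, inv_one, one_smul]
  rw [mul_assoc, ← integral_mul_const]
  rw [← Real.norm_eq_abs]
  refine norm_integral_le_of_norm_le ((integrable_one_add_norm_pow_mul η M).mul_const _)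
    (Filter.Eventually.of_forall fun y => ?_)
  have h := norm_iteratedFDeriv_le_schwartzSup (M := M) (Nat.zero_le N) f (latticePoint k + y)
  rw [norm_iteratedFDeriv_zero] at h
  have hS := schwartzSup_nonneg M N f
  calc ‖f (latticePoint k + y) * η y‖
      ≤ (schwartzSup M N f * ((1 + ‖y‖) ^ M * ((1 + ‖latticePoint k‖) ^ M)⁻¹)) * |η y| := by
        rw [norm_mul]
        refine mul_le_mul_of_nonneg_right (h.trans ?_) (norm_nonneg _)
        gcongr
        exact inv_one_add_norm_add_le _ _ _
    _ = _ := by ring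

/-- Vanishing moments give decay of the coefficients of Schwartz functions in the scale. -/
theorem abs_integral_mul_of_moments_le {d : ℕ} (η : 𝓢(Space d, ℝ))
    (hη : ∀ (m : ℕ) (L : ContinuousMultilinearMap ℝ (fun _ : Fin m => Space d) ℝ),
      ∫ x : Space d, L (fun _ => x) * η x = 0) (M n : ℕ) (f : 𝓢(Space d, ℝ)) (x : Space d) {h : ℝ}
    (h0 : 0 ≤ h) (h1 : h ≤ 1) :
    |∫ y, f (x + h • y) * η y| ≤
      (∫ y, (1 + ‖y‖) ^ (M + (n + 1)) * |η y|) * schwartzSup M (n + 1) f *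
        (h ^ (n + 1) * ((1 + ‖x‖) ^ M)⁻¹) := by
  set S := schwartzSup M (n + 1) f
  have hS : 0 ≤ S := schwartzSup_nonneg M (n + 1) f
  -- The degree-`m` Taylor term of `f` at `x` with increment `h • y`, as a multilinear form in `y`,
  -- so that the moment condition annihilates it.
  set L : ∀ m : ℕ, ContinuousMultilinearMap ℝ (fun _ : Fin m => Space d) ℝ :=
    fun m => ((m.factorial : ℝ)⁻¹ * h ^ m) • iteratedFDeriv ℝ m f x with hL
  have hLy : ∀ m y, L m (fun _ => y) =
      (m.factorial : ℝ)⁻¹ * iteratedFDeriv ℝ m f x (fun _ => h • y) := by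
    intro m y
    rw [ContinuousMultilinearMap.map_smul_univ (iteratedFDeriv ℝ m f x) (fun _ => h)]
    simp [hL, mul_assoc]
  have hLint : ∀ m, Integrable fun y => L m (fun _ => y) * η y := by
    intro m
    refine ((η.integrable_pow_mul volume m).const_mul ‖L m‖).mono' ?_
      (Filter.Eventually.of_forall fun y => ?_)
    · have : Continuous fun y : Space d => L m (fun _ => y) :=
        (L m).cont.comp (continuous_pi fun _ => continuous_id)
      exact (this.mul η.continuous).aestronglyMeasurable
    · rw [norm_mul, ← mul_assoc]
      gcongr
      simpa using (L m).le_opNorm (fun _ => y)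
  have hfint : Integrable fun y => f (x + h • y) * η y := by
    refine (η.integrable.norm.const_mul (S * 1)).mono' (by fun_prop)
      (Filter.Eventually.of_forall fun y => ?_)
    rw [norm_mul]
    gcongr
    have h2 := norm_iteratedFDeriv_le_schwartzSup (M := M) (Nat.zero_le (n + 1)) f (x + h • y)
    rw [norm_iteratedFDeriv_zero] at h2
    refine h2.trans ?_
    gcongr
    exact inv_le_one_of_one_le₀ (one_le_pow₀ (by linarith [norm_nonneg (x + h • y)]))
  have hsum : ∫ y, f (x + h • y) * η y =
      ∫ y, (f (x + h • y) - ∑ m ∈ Finset.range (n + 1), L m (fun _ => y)) * η y := by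
    simp only [sub_mul, Finset.sum_mul]
    rw [integral_sub hfint (integrable_finsetSum _ fun m _ => hLint m),
      integral_finsetSum _ fun m _ => hLint m]
    simp [hη]
  rw [hsum, mul_assoc, ← integral_mul_const]
  rw [← Real.norm_eq_abs]
  refine norm_integral_le_of_norm_le ((integrable_one_add_norm_pow_mul η _).mul_const _)
    (Filter.Eventually.of_forall fun y => ?_)
  have hhy : ∀ t ∈ Set.Icc (0 : ℝ) 1, ‖t • h • y‖ ≤ ‖y‖ := by
    intro t ht
    rw [smul_smul, norm_smul, Real.norm_eq_abs, abs_of_nonneg (mul_nonneg ht.1 h0)]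
    exact mul_le_of_le_one_left (norm_nonneg _) (mul_le_one₀ ht.2 h0 h1)
  have key := abs_sub_taylor_le (f := f) (n := n) (f.smooth _) x (h • y)
    (B := S * ((1 + ‖y‖) ^ M * ((1 + ‖x‖) ^ M)⁻¹)) fun t ht => by
      refine (norm_iteratedFDeriv_le_schwartzSup (M := M) le_rfl f _).trans ?_
      gcongr
      refine (inv_one_add_norm_add_le _ _ _).trans ?_
      gcongr
      exact hhy t ht
  simp only [hLy]
  rw [norm_mul]
  calc _ ≤ (S * ((1 + ‖y‖) ^ M * ((1 + ‖x‖) ^ M)⁻¹) * ‖h • y‖ ^ (n + 1)) * |η y| := by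
        gcongr
        · exact key
        · exact le_rfl
    _ = (1 + ‖y‖) ^ M * ‖y‖ ^ (n + 1) * |η y| * (S * (h ^ (n + 1) * ((1 + ‖x‖) ^ M)⁻¹)) := by
        rw [norm_smul, Real.norm_eq_abs, abs_of_nonneg h0, mul_pow]; ring
    _ ≤ _ := by
        rw [pow_add (1 + ‖y‖) M (n + 1)]
        gcongr
        linarith

/-- Moments give decay around the centre `2 ^ (-j) k`, whereas summation needs decay in `k`.
Expanding to order `M + n` yields `h ^ (M + n + 1)` with `h = 2 ^ (-j)`; `M` of these powers are
spent on `h (1 + ‖k‖) ≤ 1 + ‖h k‖`. -/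
theorem abs_integral_mul_wavelet_le {d : ℕ} (η : 𝓢(Space d, ℝ))
    (hη : ∀ (m : ℕ) (L : ContinuousMultilinearMap ℝ (fun _ : Fin m => Space d) ℝ),
      ∫ x : Space d, L (fun _ => x) * η x = 0) (M n : ℕ) (f : 𝓢(Space d, ℝ)) (j : ℕ)
    (k : Fin d → ℤ) :
    |∫ x, f x * dilateTranslate η j k x| ≤
      (∫ y, (1 + ‖y‖) ^ (M + (M + n + 1)) * |η y|) * schwartzSup M (M + n + 1) f *
        (((1 / 2 : ℝ) ^ j) ^ (n + 1) * ((1 + ‖latticePoint k‖) ^ M)⁻¹) := by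
  refine (abs_integral_mul_dilateTranslate_le f η j k).trans ?_
  have hh : ((2 : ℝ) ^ j)⁻¹ = (1 / 2) ^ j := by simp
  rw [hh]
  set h : ℝ := (1 / 2) ^ j
  have h0 : 0 < h := by positivity
  have h1 : h ≤ 1 := pow_le_one₀ (by norm_num) (by norm_num)
  refine (abs_integral_mul_of_moments_le η hη M (M + n) f _ h0.le h1).trans ?_
  have hI : 0 ≤ ∫ y, (1 + ‖y‖) ^ (M + (M + n + 1)) * |η y| :=
    integral_nonneg fun y => by positivity
  have hS := schwartzSup_nonneg M (M + n + 1) f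
  gcongr ?_ * ?_
  have h2 : h * (1 + ‖latticePoint k‖) ≤ 1 + ‖h • latticePoint k‖ := by
    rw [norm_smul, Real.norm_eq_abs, abs_of_pos h0]; linarith
  calc h ^ (M + n + 1) * ((1 + ‖h • latticePoint k‖) ^ M)⁻¹
      ≤ h ^ (M + n + 1) * ((h * (1 + ‖latticePoint k‖)) ^ M)⁻¹ := by gcongr
    _ = _ := by
        rw [mul_pow, add_assoc, pow_add]
        field_simp

/-- Uniform decay of the wavelet coefficients of Schwartz functions. -/
theorem WaveletBasis.exists_abs_integral_le {d : ℕ} (W : WaveletBasis d) (n : ℕ) :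
    ∃ K : ℝ, 0 ≤ K ∧ ∀ (f : 𝓢(Space d, ℝ)) (i : WaveletIndex d),
      2 ^ (n * i.level) * |∫ x, f x * waveletAtom W.φ W.ψ i x| ≤
        K * schwartzSup (2 * d) (2 * d + n + 1) f * i.decay := by
  set I : 𝓢(Space d, ℝ) → ℕ → ℝ := fun η m => ∫ y, (1 + ‖y‖) ^ m * |η y|
  have hI : ∀ η m, 0 ≤ I η m := fun η m => integral_nonneg fun y => by positivity
  refine ⟨I W.φ (2 * d) + ∑ e, I (W.ψ e) (2 * d + (2 * d + n + 1)),
    add_nonneg (hI _ _) (Finset.sum_nonneg fun e _ => hI _ _), fun f i => ?_⟩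
  have hS := schwartzSup_nonneg (2 * d) (2 * d + n + 1) f
  rcases i with k | ⟨j, e, k⟩
  · simp only [WaveletIndex.level, WaveletIndex.decay, waveletAtom, mul_zero, pow_zero, one_mul]
    refine (abs_integral_mul_translate_le W.φ (2 * d) (2 * d + n + 1) f k).trans ?_
    gcongr
    exact le_add_of_nonneg_right (Finset.sum_nonneg fun e _ => hI _ _)
  · simp only [WaveletIndex.level, WaveletIndex.decay, waveletAtom]
    have h1 := abs_integral_mul_wavelet_le (W.ψ e) (W.moments e) (2 * d) n f j k
    have h2 : I (W.ψ e) (2 * d + (2 * d + n + 1)) ≤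
        I W.φ (2 * d) + ∑ e, I (W.ψ e) (2 * d + (2 * d + n + 1)) :=
      (Finset.single_le_sum (f := fun e => I (W.ψ e) (2 * d + (2 * d + n + 1)))
        (fun e _ => hI _ _) (Finset.mem_univ e)).trans (le_add_of_nonneg_left (hI _ _))
    -- Of the `n + 1` powers, `n` pay for the growth `2 ^ (n j)`; the last one makes the sum over
    -- levels converge.
    have h3 : (2 : ℝ) ^ (n * j) * ((1 / 2 : ℝ) ^ j) ^ (n + 1) = (1 / 2) ^ j := by
      rw [mul_comm n j, pow_mul, pow_succ, ← mul_assoc, ← mul_pow, ← mul_pow]; norm_num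
    calc _ ≤ 2 ^ (n * j) * (I (W.ψ e) (2 * d + (2 * d + n + 1)) *
          schwartzSup (2 * d) (2 * d + n + 1) f *
          (((1 / 2 : ℝ) ^ j) ^ (n + 1) * ((1 + ‖latticePoint k‖) ^ (2 * d))⁻¹)) := by gcongr
      _ = I (W.ψ e) (2 * d + (2 * d + n + 1)) * schwartzSup (2 * d) (2 * d + n + 1) f *
          ((2 ^ (n * j) * ((1 / 2 : ℝ) ^ j) ^ (n + 1)) *
            ((1 + ‖latticePoint k‖) ^ (2 * d))⁻¹) := by ring
      _ ≤ _ := by rw [h3]; gcongr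

/-- Wavelet coefficients of at most exponential growth in the level are those of a tempered
distribution. -/
theorem WaveletBasis.exists_coeff_eq {d : ℕ} (W : WaveletBasis d) (ξ : WaveletIndex d → ℝ) (C : ℝ)
    (n : ℕ) (hξ : ∀ i, |ξ i| ≤ C * 2 ^ (n * i.level)) :
    ∃ g : Distr d, ∀ i, W.coeff g i = ξ i := by
  obtain ⟨K, hK, hKf⟩ := W.exists_abs_integral_le n
  set c : 𝓢(Space d, ℝ) → WaveletIndex d → ℝ :=
    fun f i => ∫ x, f x * waveletAtom W.φ W.ψ i x with hc
  have hint : ∀ (f : 𝓢(Space d, ℝ)) (i : WaveletIndex d),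
      Integrable fun x => f x * waveletAtom W.φ W.ψ i x := fun f i =>
    (f.memLp 2 volume).integrable_mul ((waveletAtom W.φ W.ψ i).memLp 2 volume)
  have hC : 0 ≤ C := by
    have := (abs_nonneg _).trans (hξ (.scaling 0))
    simpa [WaveletIndex.level] using this
  have hbound : ∀ f i, ‖ξ i * c f i‖ ≤
      C * (K * schwartzSup (2 * d) (2 * d + n + 1) f) * i.decay := by
    intro f i
    calc ‖ξ i * c f i‖ ≤ (C * 2 ^ (n * i.level)) * |c f i| := by
          rw [norm_mul]; gcongr; exacts [hξ i, le_rfl]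
      _ = C * (2 ^ (n * i.level) * |c f i|) := by ring
      _ ≤ C * (K * schwartzSup (2 * d) (2 * d + n + 1) f * i.decay) := mul_le_mul_of_nonneg_left (hKf f i) hC
      _ = _ := by ring
  have hsum : ∀ f, Summable fun i => ξ i * c f i := fun f =>
    Summable.of_norm_bounded ((summable_decay d).mul_left _) (hbound f)
  -- The distribution is `f ↦ ∑ ξ_λ ⟨f, ψ_λ⟩`, bounded by one Schwartz seminorm; orthonormality
  -- returns the coefficients `ξ_λ`.
  refine ⟨SchwartzMap.mkCLMtoNormedSpace (fun f => ∑' i, ξ i * c f i) (fun f g => ?_)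
    (fun a f => ?_) ⟨Finset.Iic (2 * d, 2 * d + n + 1),
      C * (K * 2 ^ (2 * d)) * ∑' i, WaveletIndex.decay (d := d) i, ?_, fun f => ?_⟩, fun i => ?_⟩
  · rw [← (hsum f).tsum_add (hsum g)]
    refine tsum_congr fun i => ?_
    simp only [hc, add_apply, add_mul]
    rw [integral_add (hint f i) (hint g i), mul_add]
  · rw [RingHom.id_apply, smul_eq_mul, ← tsum_mul_left]
    refine tsum_congr fun i => ?_
    simp only [hc, smul_apply, smul_eq_mul, mul_assoc]
    rw [integral_const_mul]; ring
  · have : 0 ≤ ∑' i, WaveletIndex.decay (d := d) i := tsum_nonneg fun i => by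
      cases i <;> simp only [WaveletIndex.decay] <;> positivity
    positivity
  · refine (tsum_of_norm_bounded ((summable_decay d).hasSum.mul_left _) (hbound f)).trans_eq ?_
    rw [schwartzSup]; ring
  · change ∑' i', ξ i' * c (waveletAtom W.φ W.ψ i) i' = ξ i
    rw [tsum_eq_single i]
    · simp [hc, W.normalized i]
    · intro i' hi
      simp [hc, W.orthogonal i i' hi.symm]

/-! ### Strong convexity of `|t| ^ p` on bounded intervals. -/

/-- Mean value inequality: as `q - 1 ≤ 0`, the derivative `q x ^ (q - 1)` on `(0, M)` is at least
its value at `M`. -/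
theorem mul_sub_le_rpow_sub {q M s t : ℝ} (hq : 0 < q) (hq1 : q ≤ 1) (hs : 0 ≤ s) (hst : s ≤ t)
    (ht : t ≤ M) : q * M ^ (q - 1) * (t - s) ≤ t ^ q - s ^ q := by
  refine Convex.mul_sub_le_image_sub_of_le_deriv (f := fun x => x ^ q) (convex_Icc 0 M)
    (Real.continuous_rpow_const hq.le).continuousOn ?_ ?_ s ⟨hs, hst.trans ht⟩ t
    ⟨hs.trans hst, ht⟩ hst
  · rw [interior_Icc]
    exact fun x hx => (Real.differentiableAt_rpow_const_of_ne q hx.1.ne').differentiableWithinAt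
  · rw [interior_Icc]
    intro x hx
    rw [Real.deriv_rpow_const]
    exact mul_le_mul_of_nonneg_left
      (Real.rpow_le_rpow_of_nonpos hx.1 hx.2.le (by linarith)) hq.le

theorem abs_rpow_sub_two_mul_of_nonneg {p t : ℝ} (hp : 1 < p) (ht : 0 ≤ t) :
    |t| ^ (p - 2) * t = t ^ (p - 1) := by
  rcases ht.eq_or_lt with rfl | h
  · rw [mul_zero, Real.zero_rpow (by linarith)]
  · rw [abs_of_pos h, ← Real.rpow_add_one h.ne']; ring_nf

/-- Strong monotonicity of `t ↦ |t| ^ (p - 2) t` on bounded sets, for `1 < p ≤ 2`. -/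
theorem mul_sub_le_abs_rpow_mul_sub {p M s t : ℝ} (hp : 1 < p) (hp2 : p ≤ 2) (hs : |s| ≤ M)
    (ht : |t| ≤ M) (hst : s ≤ t) :
    (p - 1) * M ^ (p - 2) * (t - s) ≤ |t| ^ (p - 2) * t - |s| ^ (p - 2) * s := by
  -- The function is odd, so the nonnegative case suffices; arguments of opposite sign are compared
  -- through `0`.
  have key : ∀ {a b : ℝ}, 0 ≤ a → a ≤ b → b ≤ M →
      (p - 1) * M ^ (p - 2) * (b - a) ≤ |b| ^ (p - 2) * b - |a| ^ (p - 2) * a := by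
    intro a b ha hab hb
    rw [abs_rpow_sub_two_mul_of_nonneg hp ha, abs_rpow_sub_two_mul_of_nonneg hp (ha.trans hab)]
    have := mul_sub_le_rpow_sub (q := p - 1) (by linarith) (by linarith) ha hab hb
    rwa [show p - 1 - 1 = p - 2 by ring] at this
  rw [abs_le] at hs ht
  rcases le_total 0 s with h | h
  · exact key h hst ht.2
  · rcases le_total t 0 with h' | h'
    · have := key (neg_nonneg.2 h') (neg_le_neg hst) (by linarith)
      rw [abs_neg, abs_neg] at this
      linarith
    · have h1 := key le_rfl h' ht.2
      have h2 := key le_rfl (neg_nonneg.2 h) (by linarith)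
      rw [abs_neg] at h2
      linarith

/-- Strong convexity of `|·| ^ p` on bounded sets, for `1 < p ≤ 2`. -/
theorem mul_sub_sq_le_abs_rpow {p M a b : ℝ} (hp : 1 < p) (hp2 : p ≤ 2) (ha : |a| ≤ M)
    (hb : |b| ≤ M) :
    p * (p - 1) / 2 * M ^ (p - 2) * (a - b) ^ 2 ≤
      |a| ^ p - |b| ^ p - p * |b| ^ (p - 2) * b * (a - b) := by
  set κ := (p - 1) * M ^ (p - 2) with hκ
  -- After subtracting this quadratic the derivative is still monotone on `[-M, M]`, so `h` lies
  -- above its tangent at `b` there.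
  set h : ℝ → ℝ := fun t => |t| ^ p - p * κ / 2 * t ^ 2 with hh
  have hderiv : ∀ t, HasDerivAt h (p * (|t| ^ (p - 2) * t - κ * t)) t := by
    intro t
    refine ((hasDerivAt_abs_rpow t hp).sub ((hasDerivAt_pow 2 t).const_mul (p * κ / 2))).congr_deriv
      ?_
    push_cast; ring
  have hcont : Continuous h := continuous_iff_continuousAt.2 fun t => (hderiv t).continuousAt
  have hmono : ∀ s t, |s| ≤ M → |t| ≤ M → s ≤ t →
      p * (|s| ^ (p - 2) * s - κ * s) ≤ p * (|t| ^ (p - 2) * t - κ * t) := by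
    intro s t hs ht hst
    have := mul_sub_le_abs_rpow_mul_sub hp hp2 hs ht hst
    refine mul_le_mul_of_nonneg_left ?_ (by linarith)
    linarith
  have hmain : p * (|b| ^ (p - 2) * b - κ * b) * (a - b) ≤ h a - h b := by
    rw [abs_le] at ha hb
    rcases lt_trichotomy a b with hab | rfl | hab
    · obtain ⟨c, hc, hc'⟩ := exists_hasDerivAt_eq_slope h _ hab hcont.continuousOn
        fun x _ => hderiv x
      rw [eq_div_iff (by linarith)] at hc'
      have := hmono c b (abs_le.2 ⟨by linarith [hc.1], by linarith [hc.2]⟩)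
        (abs_le.2 hb) hc.2.le
      nlinarith
    · simp
    · obtain ⟨c, hc, hc'⟩ := exists_hasDerivAt_eq_slope h _ hab hcont.continuousOn
        fun x _ => hderiv x
      rw [eq_div_iff (by linarith)] at hc'
      have := hmono b c (abs_le.2 hb) (abs_le.2 ⟨by linarith [hc.1], by linarith [hc.2]⟩) hc.1.le
      nlinarith
  have e : p * (p - 1) / 2 * M ^ (p - 2) = p * κ / 2 := by rw [hκ]; ring
  rw [e]
  simp only [hh] at hmain
  linarith

theorem abs_abs_rpow_sub_two_mul {p : ℝ} (hp : 1 < p) (t : ℝ) :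
    |(|t| ^ (p - 2) * t)| = |t| ^ (p - 1) := by
  rw [abs_mul, abs_of_nonneg (by positivity : 0 ≤ |t| ^ (p - 2))]
  simpa using abs_rpow_sub_two_mul_of_nonneg hp (abs_nonneg t)

theorem abs_rpow_sub_two_mul_mul_self {p : ℝ} (hp : 1 < p) (t : ℝ) :
    |t| ^ (p - 2) * t * t = |t| ^ p := by
  rcases eq_or_ne t 0 with rfl | h
  · simp [Real.zero_rpow (by linarith : p ≠ 0)]
  · rw [mul_assoc, ← sq, ← sq_abs, ← Real.rpow_natCast, ← Real.rpow_add (abs_pos.2 h)]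
    norm_num

/-! ### Besov spaces as weighted sequence spaces. -/

theorem le_tsum_rpow_inv {ι : Type*} {z : ι → ℝ} {p : ℝ} (hp : 0 < p) (hz : ∀ i, 0 ≤ z i)
    (hs : Summable fun i => z i ^ p) (i : ι) : z i ≤ (∑' i, z i ^ p) ^ p⁻¹ := by
  rw [Real.le_rpow_inv_iff_of_pos (hz i) (tsum_nonneg fun i => Real.rpow_nonneg (hz i) p) hp]
  exact hs.le_tsum i fun j _ => Real.rpow_nonneg (hz j) p

/-- The embedding `ℓ^q ⊆ ℓ^p`: terms are bounded by the `ℓ^q` norm, which absorbs the extra power `p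
- q`. It passes from `p_S` to `p`. -/
theorem summable_rpow_of_le {ι : Type*} {z : ι → ℝ} {q p : ℝ} (hq : 0 < q) (hqp : q ≤ p)
    (hz : ∀ i, 0 ≤ z i) (hs : Summable fun i => z i ^ q) : Summable fun i => z i ^ p := by
  refine Summable.of_nonneg_of_le (fun i => Real.rpow_nonneg (hz i) p) (fun i => ?_)
    (hs.mul_left (((∑' i, z i ^ q) ^ q⁻¹) ^ (p - q)))
  have h := le_tsum_rpow_inv hq hz hs i
  rcases (hz i).eq_or_lt with h0 | h0
  · rw [← h0, Real.zero_rpow (by linarith), Real.zero_rpow (by linarith), mul_zero]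
  · calc z i ^ p = z i ^ (p - q) * z i ^ q := by rw [← Real.rpow_add h0]; ring_nf
      _ ≤ _ := by
        gcongr

/-- The weighted wavelet coefficient `2 ^ (τ |λ|) u_λ`. -/
def WaveletBasis.wcoeff {d : ℕ} (W : WaveletBasis d) (τ : ℝ) (u : Distr d) (i : WaveletIndex d) :
    ℝ := (2 : ℝ) ^ (τ * i.level) * W.coeff u i

theorem two_rpow_mul_abs_rpow (p τ l c : ℝ) :
    (2 : ℝ) ^ (p * τ * l) * |c| ^ p = |(2 : ℝ) ^ (τ * l) * c| ^ p := by
  rw [abs_mul, abs_of_nonneg (by positivity : (0 : ℝ) ≤ 2 ^ (τ * l)),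
    Real.mul_rpow (by positivity) (abs_nonneg _), ← Real.rpow_mul two_pos.le]
  ring_nf

theorem besovNorm_eq {d : ℕ} (W : WaveletBasis d) (s p : ℝ) (u : Distr d) :
    besovNorm W s p u =
      (∑' i, ENNReal.ofReal (|W.wcoeff (rateExponent d s p) u i| ^ p)) ^ (1 / p) := by
  simp only [besovNorm, two_rpow_mul_abs_rpow, WaveletBasis.wcoeff, rateExponent]

theorem besovNorm_rpow {d : ℕ} (W : WaveletBasis d) (s : ℝ) {p : ℝ} (hp : 0 < p) (u : Distr d) :
    besovNorm W s p u ^ p =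
      ∑' i, ENNReal.ofReal (|W.wcoeff (rateExponent d s p) u i| ^ p) := by
  rw [besovNorm_eq, ← ENNReal.rpow_mul, one_div, inv_mul_cancel₀ hp.ne', ENNReal.rpow_one]

theorem summable_of_tsum_ofReal_ne_top {ι : Type*} {f : ι → ℝ} (hf : ∀ i, 0 ≤ f i)
    (h : ∑' i, ENNReal.ofReal (f i) ≠ ⊤) : Summable f := by
  have := ENNReal.summable_toReal h
  simpa only [ENNReal.toReal_ofReal (hf _)] using this

theorem mem_besovSpace_iff {d : ℕ} (W : WaveletBasis d) (s p : ℝ) (hp : 0 < p) (u : Distr d) :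
    u ∈ besovSpace W s p hp ↔ Summable fun i => |W.wcoeff (rateExponent d s p) u i| ^ p := by
  have h0 : u ∈ besovSpace W s p hp ↔ besovNorm W s p u < ⊤ := Iff.rfl
  rw [h0, besovNorm_eq, ENNReal.rpow_lt_top_iff_of_pos (by positivity)]
  constructor
  · intro h
    exact summable_of_tsum_ofReal_ne_top (fun i => by positivity) h.ne
  · intro h
    exact h.tsum_ofReal_lt_top

/-- A sequence in the coefficient space of `B^s_p` belongs to an element of `B^s_p`. -/
theorem exists_mem_besovSpace_coeff_eq {d : ℕ} (W : WaveletBasis d) (s p : ℝ) (hp : 0 < p)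
    (ξ : WaveletIndex d → ℝ)
    (hξ : Summable fun i => |(2 : ℝ) ^ (rateExponent d s p * i.level) * ξ i| ^ p) :
    ∃ g ∈ besovSpace W s p hp, ∀ i, W.coeff g i = ξ i := by
  set τ := rateExponent d s p
  have hb := le_tsum_rpow_inv hp (fun i => abs_nonneg _) hξ
  -- Summability bounds `|ξ_λ|` by a multiple of `2 ^ (-τ|λ|)`; rounding `-τ` up gives the natural
  -- growth exponent.
  obtain ⟨g, hg⟩ := W.exists_coeff_eq ξ _ ⌈-τ⌉₊ fun i => by
    have h1 := hb i
    rw [abs_mul, abs_of_nonneg (by positivity)] at h1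
    calc |ξ i| = (2 : ℝ) ^ (τ * i.level) * |ξ i| * (2 : ℝ) ^ (-τ * i.level) := by
          rw [mul_right_comm, ← Real.rpow_add two_pos]; simp
      _ ≤ _ * (2 : ℝ) ^ (⌈-τ⌉₊ * i.level) := by
          refine mul_le_mul h1 ?_ (by positivity) ((by positivity : (0:ℝ) ≤ _).trans h1)
          rw [← Real.rpow_natCast]
          refine Real.rpow_le_rpow_of_exponent_le one_le_two ?_
          push_cast
          gcongr
          exact Nat.le_ceil _
  refine ⟨g, ?_, hg⟩
  rw [mem_besovSpace_iff]
  simpa only [WaveletBasis.wcoeff, hg] using hξ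

/-! ### Convergence rates from source conditions. -/

/-- The elementary estimate behind the convergence rates under a source condition. -/
theorem bregman_le {E : Type*} [NormedAddCommGroup E] [InnerProductSpace ℝ E] (w v v₀ y : E)
    {α δ D : ℝ} (hα : 0 ≤ α) (hδ : ‖v₀ - y‖ ≤ δ)
    (h : ‖v - y‖ ^ 2 + α * (D + inner ℝ w (v - v₀)) ≤ δ ^ 2) :
    α * D ≤ δ ^ 2 + α * ‖w‖ * δ + α ^ 2 * ‖w‖ ^ 2 := by
  have h1 : -inner ℝ w (v - v₀) ≤ ‖w‖ * ‖v - v₀‖ :=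
    (neg_le_abs _).trans (abs_real_inner_le_norm _ _)
  have h2 : ‖v - v₀‖ ≤ ‖v - y‖ + δ := by
    calc ‖v - v₀‖ = ‖(v - y) - (v₀ - y)‖ := by rw [sub_sub_sub_cancel_right]
      _ ≤ ‖v - y‖ + ‖v₀ - y‖ := norm_sub_le _ _
      _ ≤ _ := by gcongr
  have h3 : α * (‖w‖ * ‖v - v₀‖) ≤ α * (‖w‖ * (‖v - y‖ + δ)) := by gcongr
  have h4 := mul_le_mul_of_nonneg_left h1 hα
  -- Completing the square lets `‖v - y‖ ^ 2` absorb `α ‖w‖ ‖v - y‖`.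
  nlinarith [sq_nonneg (‖v - y‖ - α * ‖w‖ / 2), sq_nonneg (α * ‖w‖)]

section Rate

variable {d : ℕ} {W : WaveletBasis d} {sD pD : ℝ} {hD : 0 < pD}

/-- If a subgradient of the penalty at `uDag` lies in the range of `F*`, then the Tikhonov
minimizers converge with the rate `√δ`. -/
theorem convergenceRate_of_subgradient (F : besovSpace W sD pD hD →ₗ[ℝ] L2 d)
    (uDag : besovSpace W sD pD hD) (s : ℝ) {p : ℝ} (hp : 1 < p) (hp2 : p ≤ 2) (g : Distr d)
    (hg : g ∈ adjointRange F)
    (hgc : ∀ i, W.coeff g i = (2 : ℝ) ^ (rateExponent d s p * i.level) *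
      (p * (|W.wcoeff (rateExponent d s p) uDag i| ^ (p - 2) *
        W.wcoeff (rateExponent d s p) uDag i))) :
    ConvergenceRate F uDag s p (rateExponent d s p) := by
  set τ := rateExponent d s p
  have hp0 : 0 < p := by linarith
  obtain ⟨w, hw⟩ := hg
  set x₀ : WaveletIndex d → ℝ := W.wcoeff τ uDag with hx₀
  have hw' : ∀ u : besovSpace W sD pD hD,
      HasSum (fun i => p * |x₀ i| ^ (p - 2) * x₀ i * W.wcoeff τ u i) (inner ℝ w (F u)) := by
    intro u
    convert hw u using 2 with i
    rw [hgc, WaveletBasis.wcoeff]; ring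
  -- Finiteness of the penalty at `u†` comes for free: pairing the subgradient with `u†` itself
  -- gives `p` times the penalty.
  have hR₀ : Summable fun i => |x₀ i| ^ p := by
    refine ((hw' uDag).summable.mul_left p⁻¹).congr fun i => ?_
    rw [← abs_rpow_sub_two_mul_mul_self hp]
    rw [← hx₀, mul_assoc p, mul_assoc p, inv_mul_cancel_left₀ hp0.ne']
  set R₀ := ∑' i, |x₀ i| ^ p
  have hR₀nn : 0 ≤ R₀ := tsum_nonneg fun i => by positivity
  intro a b ha hb
  -- `B` bounds the penalty at `u†` and at every minimizer, because `δ ^ 2 ≤ δ ≤ α / a`. Hence `M`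
  -- bounds all weighted coefficients, and `κ` is a uniform convexity modulus.
  set B := R₀ + 1 / a + 1
  have hBpos : 0 < B := by positivity
  set M := B ^ p⁻¹
  have hMpos : 0 < M := by positivity
  set κ := p * (p - 1) / 2 * M ^ (p - 2) with hκ
  have hκpos : 0 < κ := by
    have : 0 < p - 1 := by linarith
    positivity
  set K₁ := (1 / a + ‖w‖ + b * ‖w‖ ^ 2) / κ with hK₁
  have hK₁pos : 0 < K₁ := by positivity
  refine ⟨√K₁, 1, by positivity, one_pos, fun δ hδ hδ1 α hα hα' y hy u hu => ?_⟩
  have hαpos : 0 < α := lt_of_lt_of_le (by positivity) hα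
  set x : WaveletIndex d → ℝ := W.wcoeff τ u with hx
  have hmin := hu uDag
  have htik : ∀ v : besovSpace W sD pD hD, tikhonov F s p α y v = ENNReal.ofReal (‖F v - y‖ ^ 2) +
      ENNReal.ofReal α * ∑' i, ENNReal.ofReal (|W.wcoeff τ v i| ^ p) := fun v => by
    rw [tikhonov, besovNorm_rpow W s hp0]
  have htik' : ∀ v : besovSpace W sD pD hD, (Summable fun i => |W.wcoeff τ v i| ^ p) →
      tikhonov F s p α y v =
        ENNReal.ofReal (‖F v - y‖ ^ 2 + α * ∑' i, |W.wcoeff τ v i| ^ p) := fun v hv => by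
    rw [htik, ENNReal.ofReal_add (by positivity)
      (mul_nonneg hαpos.le (tsum_nonneg fun i => by positivity)), ENNReal.ofReal_mul hαpos.le,
      ENNReal.ofReal_tsum_of_nonneg (fun i => by positivity) hv]
  rw [htik' uDag hR₀] at hmin
  have hR : Summable fun i => |x i| ^ p := by
    refine summable_of_tsum_ofReal_ne_top (fun i => by positivity) fun htop => ?_
    rw [htik u, htop, ENNReal.mul_top (by simpa using hαpos), add_top] at hmin
    exact ENNReal.ofReal_ne_top (top_le_iff.1 hmin)
  rw [htik' u hR, ENNReal.ofReal_le_ofReal_iff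
    (add_nonneg (by positivity) (mul_nonneg hαpos.le hR₀nn))] at hmin
  set R := ∑' i, |x i| ^ p
  have hδ2 : ‖F uDag - y‖ ^ 2 ≤ δ ^ 2 := by gcongr
  have hαδ : δ ≤ α / a := by rw [le_div_iff₀ ha]; linarith
  have hRB : R ≤ B := by
    have h1 : α * R ≤ α * (R₀ + 1 / a) := by
      have : δ ^ 2 ≤ α * (1 / a) := by
        calc δ ^ 2 ≤ 1 * δ := by nlinarith
          _ ≤ α / a := by linarith
          _ = _ := by ring
      nlinarith [sq_nonneg ‖F u - y‖]
    linarith [le_of_mul_le_mul_left h1 hαpos]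
  have hxM : ∀ i, |x i| ≤ M := fun i =>
    (le_tsum_rpow_inv hp0 (fun i => abs_nonneg (x i)) hR i).trans
      (Real.rpow_le_rpow (tsum_nonneg fun i => by positivity) hRB (by positivity))
  have hx₀M : ∀ i, |x₀ i| ≤ M := fun i =>
    (le_tsum_rpow_inv hp0 (fun i => abs_nonneg (x₀ i)) hR₀ i).trans
      (Real.rpow_le_rpow hR₀nn
        (by linarith [(by positivity : 0 < 1 / a)]) (by positivity))
  have hxi : HasSum (fun i => p * |x₀ i| ^ (p - 2) * x₀ i * (x i - x₀ i))
      (inner ℝ w (F u - F uDag)) := by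
    rw [inner_sub_right]
    simpa only [mul_sub] using (hw' u).sub (hw' uDag)
  -- The Bregman distance, summed coefficientwise; `hle` bounds each term below by strong convexity.
  have hD : HasSum (fun i => |x i| ^ p - |x₀ i| ^ p - p * |x₀ i| ^ (p - 2) * x₀ i * (x i - x₀ i))
      (R - R₀ - inner ℝ w (F u - F uDag)) := (hR.hasSum.sub hR₀.hasSum).sub hxi
  have hle : ∀ i, κ * (x i - x₀ i) ^ 2 ≤
      |x i| ^ p - |x₀ i| ^ p - p * |x₀ i| ^ (p - 2) * x₀ i * (x i - x₀ i) := fun i =>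
    mul_sub_sq_le_abs_rpow hp hp2 (hxM i) (hx₀M i)
  have hS : Summable fun i => (x i - x₀ i) ^ 2 := by
    refine (summable_mul_left_iff hκpos.ne').1 ?_
    exact Summable.of_nonneg_of_le (fun i => by positivity) hle hD.summable
  have hSle : κ * ∑' i, (x i - x₀ i) ^ 2 ≤ R - R₀ - inner ℝ w (F u - F uDag) := by
    rw [← tsum_mul_left, ← hD.tsum_eq]
    exact (hS.mul_left κ).tsum_le_tsum hle hD.summable
  have hbreg := bregman_le w (F u) (F uDag) y (D := R - R₀ - inner ℝ w (F u - F uDag)) hαpos.le hy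
    (by linarith)
  have hfin : ∑' i, (x i - x₀ i) ^ 2 ≤ K₁ * δ := by
    have h1 : α * (κ * ∑' i, (x i - x₀ i) ^ 2) ≤ α * ((1 / a + ‖w‖ + b * ‖w‖ ^ 2) * δ) := by
      calc _ ≤ δ ^ 2 + α * ‖w‖ * δ + α ^ 2 * ‖w‖ ^ 2 :=
            (mul_le_mul_of_nonneg_left hSle hαpos.le).trans hbreg
        _ ≤ δ * (α / a) + α * ‖w‖ * δ + α * (b * δ) * ‖w‖ ^ 2 := by
            rw [sq δ, sq α]; gcongr
        _ = _ := by ring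
    have h2 := le_of_mul_le_mul_left h1 hαpos
    rw [hK₁, div_mul_eq_mul_div, le_div_iff₀ hκpos]
    linarith
  have hτ : rateExponent d τ 2 = τ := by simp [rateExponent]
  have hdiff : ∀ i, |W.wcoeff τ ((u : Distr d) - (uDag : Distr d)) i| ^ (2 : ℝ) =
      (x i - x₀ i) ^ 2 := fun i => by
    rw [Real.rpow_two, sq_abs, hx, hx₀]
    simp only [WaveletBasis.wcoeff]
    rw [← mul_sub]
    rfl
  rw [besovNorm_eq, hτ]
  simp only [hdiff]
  rw [← ENNReal.ofReal_tsum_of_nonneg (fun i => by positivity) hS,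
    ENNReal.ofReal_rpow_of_nonneg (tsum_nonneg fun i => by positivity) (by positivity)]
  refine ENNReal.ofReal_le_ofReal ?_
  rw [← Real.sqrt_mul hK₁pos.le, ← Real.sqrt_eq_rpow]
  exact Real.sqrt_le_sqrt hfin

/-- Elements of `B^{s_S}_{p_S}` satisfy the source condition of all allowed penalties. -/
theorem convergenceRate_of_mem (F : besovSpace W sD pD hD →ₗ[ℝ] L2 d)
    {sS pS sG pG ε p sR pR : ℝ} (hpS : 0 < pS) (hpG : 0 < pG) (hε : 0 ≤ ε)
    (hFG : (besovSpace W sG pG hpG : Set (Distr d)) ⊆ adjointRange F)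
    (hSp : pS ≤ p) (hpp : p ≤ pG) (hpR : pR = (p + pG) / pG)
    (hsR : sR ≤ smoothnessBound d sS pS sG pG ε p)
    (uDag : besovSpace W sD pD hD) (hu : (uDag : Distr d) ∈ besovSpace W sS pS hpS) :
    ConvergenceRate F uDag sR pR (rateExponent d sR pR) := by
  have hp : 0 < p := hpS.trans_le hSp
  have hpR1 : 1 < pR := by rw [hpR, lt_div_iff₀ hpG]; linarith
  have hpR2 : pR ≤ 2 := by rw [hpR, div_le_iff₀ hpG]; linarith
  set τ := rateExponent d sR pR with hτ
  set ρ := rateExponent d sS pS with hρ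
  set γ := rateExponent d sG pG with hγ
  rw [mem_besovSpace_iff] at hu
  have hu' := summable_rpow_of_le hpS hSp (fun i => abs_nonneg _) hu
  -- Comparison of level weights: the left side is the weight in the `p_G`-th power of the
  -- subgradient, the right side that in the `p`-th power of `u†`. Equality holds when `ε = 0` and
  -- `s_R` is maximal.
  have hexp : pG * γ + pG * τ + p * τ ≤ p * ρ := by
    have h1 : pG * γ + pG * τ + p * τ =
        pG * (sG + d * (1 / 2 - 1 / pG)) + (p + pG) * (sR + d * (1 / 2 - pG / (p + pG))) := by
      rw [hγ, hτ, hpR, rateExponent, rateExponent, one_div_div]; ring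
    have h2 : (p + pG) * sR ≤ (p + pG) * smoothnessBound d sS pS sG pG 0 p := by
      refine mul_le_mul_of_nonneg_left (hsR.trans ?_) (by positivity)
      have : 0 ≤ p / pS - 1 := by rw [sub_nonneg, one_le_div hpS]; exact hSp
      simp only [smoothnessBound]
      nlinarith [mul_nonneg hε this]
    have h3 : (p + pG) * smoothnessBound d sS pS sG pG 0 p =
        p * sS - pG * sG - d * (p / pS - 1) := by
      rw [smoothnessBound]; field_simp; ring
    have h4 : (p + pG) * (d * (1 / 2 - pG / (p + pG))) = d * ((p + pG) / 2 - pG) := by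
      field_simp
    have h5 : pG * (d * (1 / 2 - 1 / pG)) = d * (pG / 2 - 1) := by field_simp
    have h6 : p * ρ = p * sS + d * (p / 2 - p / pS) := by rw [hρ, rateExponent]; ring
    rw [h1, mul_add, mul_add, h4, h5, h6]
    nlinarith
  obtain ⟨g, hgG, hgc⟩ := exists_mem_besovSpace_coeff_eq W sG pG hpG
    (fun i => (2 : ℝ) ^ (τ * i.level) *
      (pR * (|W.wcoeff τ uDag i| ^ (pR - 2) * W.wcoeff τ uDag i))) (by
    refine Summable.of_nonneg_of_le (fun i => by positivity) (fun i => ?_)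
      (hu'.mul_left (pR ^ pG))
    set c := W.coeff (uDag : Distr d) i with hc
    have hl : (0 : ℝ) ≤ i.level := by positivity
    have e1 : |W.wcoeff τ uDag i| = (2 : ℝ) ^ (τ * i.level) * |c| := by
      rw [WaveletBasis.wcoeff, abs_mul, abs_of_nonneg (by positivity)]
    have e2 : |W.wcoeff ρ uDag i| = (2 : ℝ) ^ (ρ * i.level) * |c| := by
      rw [WaveletBasis.wcoeff, abs_mul, abs_of_nonneg (by positivity)]
    have e3 : (pR - 1) * pG = p := by rw [hpR]; field_simp; ring
    rw [abs_mul, abs_mul, abs_mul, abs_abs_rpow_sub_two_mul hpR1, abs_of_nonneg (by positivity),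
      abs_of_nonneg (by positivity), abs_of_nonneg (by linarith : 0 ≤ pR),
      Real.mul_rpow (by positivity) (by positivity), Real.mul_rpow (by positivity) (by positivity),
      Real.mul_rpow (by positivity) (by positivity), ← Real.rpow_mul (abs_nonneg _), e3, e1, e2,
      Real.mul_rpow (by positivity) (by positivity), Real.mul_rpow (by positivity) (by positivity),
      ← Real.rpow_mul two_pos.le, ← Real.rpow_mul two_pos.le, ← Real.rpow_mul two_pos.le,
      ← Real.rpow_mul two_pos.le]
    calc _ = pR ^ pG * ((2 : ℝ) ^ ((pG * γ + pG * τ + p * τ) * i.level) * |c| ^ p) := by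
          rw [show (pG * γ + pG * τ + p * τ) * (i.level : ℝ) = γ * i.level * pG +
            τ * i.level * pG + τ * i.level * p by ring, Real.rpow_add two_pos,
            Real.rpow_add two_pos]
          ring
      _ ≤ _ := by
          rw [show ρ * (i.level : ℝ) * p = (p * ρ) * i.level by ring]
          gcongr
          exact one_le_two)
  exact convergenceRate_of_subgradient F uDag sR hpR1 hpR2 g (hFG hgG) hgc

end Rate

/-! ### Maximization of the exponent. -/

theorem rateExponent_smoothnessBound (d : ℕ) (sS pS sG ε : ℝ) {pG p : ℝ} (hpG : 0 < pG)
    (hp : 0 < p) :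
    rateExponent d (smoothnessBound d sS pS sG pG ε p) ((p + pG) / pG) =
      (p * (sS - d / pS + d / 2) - pG * (sG - d / pG + d / 2)) / (p + pG) - ε * (p / pS - 1) := by
  have h : p + pG ≠ 0 := by positivity
  rw [rateExponent, smoothnessBound, one_div_div]
  field_simp
  ring

theorem optRate_eq (d : ℕ) (sG ε sS pS : ℝ) {pD pG : ℝ} (hpD : 0 < pD) (hpG : 0 < pG) :
    optRate d pD sG pG ε sS pS =
      (min pD pG * (sS - d / pS + d / 2) - pG * (sG - d / pG + d / 2)) / (min pD pG + pG) -
        ε * (min pD pG / pS - 1) :=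
  rateExponent_smoothnessBound d sS pS sG ε hpG (lt_min hpD hpG)

theorem allowedPenalty_opt (d : ℕ) (sS sG ε : ℝ) {pS pD pG : ℝ} (hpD : 0 < pD) (hpG : 0 < pG)
    (hSD : pS ≤ pD) (hSG : pS ≤ pG) :
    AllowedPenalty d sS pS pD sG pG ε (optS d sS pS pD sG pG ε) (optP pD pG) :=
  ⟨min pD pG, lt_min hpD hpG, le_min hSD hSG, le_rfl, rfl, le_rfl⟩

/-- The exponent grows strictly with `p` when `ε` is small. -/
theorem rateExponent_smoothnessBound_lt {d : ℕ} {sS pS sG pG ε p q : ℝ} (hpS : 0 < pS)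
    (hpG : 0 < pG) (hp : 0 < p) (hpq : p < q) (hq : q ≤ pG)
    (hε : ε < pS * ((sS - d / pS + d / 2) + (sG - d / pG + d / 2)) / (4 * pG))
    (hAB : 0 < (sS - d / pS + d / 2) + (sG - d / pG + d / 2)) :
    rateExponent d (smoothnessBound d sS pS sG pG ε p) ((p + pG) / pG) <
      rateExponent d (smoothnessBound d sS pS sG pG ε q) ((q + pG) / pG) := by
  have hq0 : 0 < q := hp.trans hpq
  rw [rateExponent_smoothnessBound d sS pS sG ε hpG hp,
    rateExponent_smoothnessBound d sS pS sG ε hpG hq0]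
  set A := sS - d / pS + d / 2
  set B := sG - d / pG + d / 2
  -- Per unit of `p` the fraction gains at least `(A + B) / (4 p_G)`, as `p, q ≤ p_G`, while the
  -- `ε`-term loses `ε / p_S`; the threshold for `ε` is where these two balance.
  have e : ((q * A - pG * B) / (q + pG) - ε * (q / pS - 1)) -
      ((p * A - pG * B) / (p + pG) - ε * (p / pS - 1)) =
      (q - p) * (pG * (A + B) / ((p + pG) * (q + pG)) - ε / pS) := by
    field_simp
    ring
  have h1 : ε / pS < (A + B) / (4 * pG) := by
    rw [div_lt_iff₀ hpS]
    calc ε < _ := hε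
      _ = _ := by ring
  have h2 : (A + B) / (4 * pG) ≤ pG * (A + B) / ((p + pG) * (q + pG)) := by
    rw [div_le_div_iff₀ (by positivity) (by positivity)]
    have : (p + pG) * (q + pG) ≤ (2 * pG) * (2 * pG) := by
      apply mul_le_mul <;> linarith
    nlinarith
  have h3 : 0 < (q - p) * (pG * (A + B) / ((p + pG) * (q + pG)) - ε / pS) :=
    mul_pos (by linarith) (by linarith)
  linarith

theorem besovNorm_two_mono {d : ℕ} (W : WaveletBasis d) {σ τ : ℝ} (h : σ ≤ τ) (u : Distr d) :
    besovNorm W σ 2 u ≤ besovNorm W τ 2 u := by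
  refine ENNReal.rpow_le_rpow (ENNReal.tsum_le_tsum fun i => ENNReal.ofReal_le_ofReal ?_)
    (by norm_num)
  gcongr
  exact one_le_two

/-- The optimal penalty is the unique allowed penalty with the largest exponent. -/
theorem allowedPenalty_rateExponent_le {d : ℕ} {sS pS pD sG pG ε sR pR : ℝ} (hpS : 0 < pS)
    (hpG : 0 < pG)
    (hε : ε < pS * ((sS - d / pS + d / 2) + (sG - d / pG + d / 2)) / (4 * pG))
    (hAB : 0 < (sS - d / pS + d / 2) + (sG - d / pG + d / 2))
    (h : AllowedPenalty d sS pS pD sG pG ε sR pR) :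
    rateExponent d sR pR ≤ optRate d pD sG pG ε sS pS ∧
      (rateExponent d sR pR = optRate d pD sG pG ε sS pS →
        sR = optS d sS pS pD sG pG ε ∧ pR = optP pD pG) := by
  obtain ⟨p, hp, -, hpq, rfl, hsR⟩ := h
  have h1 : rateExponent d sR ((p + pG) / pG) ≤
      rateExponent d (smoothnessBound d sS pS sG pG ε p) ((p + pG) / pG) := by
    simpa only [rateExponent, add_le_add_iff_right] using hsR
  rcases hpq.eq_or_lt with hq | hq
  · subst hq
    refine ⟨h1, fun he => ⟨?_, rfl⟩⟩
    exact add_right_cancel he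
  · have h2 := rateExponent_smoothnessBound_lt hpS hpG hp hq (min_le_right _ _) hε hAB
    have h3 := h1.trans_lt h2
    exact ⟨h3.le, fun he => absurd he h3.ne⟩

theorem optRate_sub (d : ℕ) (sG sS pS sT pT : ℝ) {pD pG : ℝ} (hpD : 0 < pD) (hpG : 0 < pG) :
    optRate d pD sG pG 0 sT pT - optRate d pD sG pG 0 sS pS =
      min pD pG / (min pD pG + pG) * (sT - d / pT - (sS - d / pS)) := by
  rw [optRate_eq d sG 0 sT pT hpD hpG, optRate_eq d sG 0 sS pS hpD hpG]
  ring

theorem exists_forall_optRate_lt {d : ℕ} {sG sS pS sT pT pD pG : ℝ} (hpD : 0 < pD) (hpG : 0 < pG)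
    (h : optRate d pD sG pG 0 sS pS < optRate d pD sG pG 0 sT pT) :
    ∃ ε₁ : ℝ, 0 < ε₁ ∧ ∀ ε : ℝ, 0 < ε → ε < ε₁ →
      optRate d pD sG pG ε sS pS < optRate d pD sG pG ε sT pT := by
  simp only [optRate_eq d sG _ _ _ hpD hpG] at h ⊢
  have hcont : ∀ s p : ℝ, Filter.Tendsto (fun ε : ℝ =>
      (min pD pG * (s - d / p + d / 2) - pG * (sG - d / pG + d / 2)) / (min pD pG + pG) -
        ε * (min pD pG / p - 1)) (nhds 0) (nhds ((min pD pG * (s - d / p + d / 2) -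
          pG * (sG - d / pG + d / 2)) / (min pD pG + pG) - 0 * (min pD pG / p - 1))) :=
    fun s p => Continuous.tendsto (by fun_prop) 0
  obtain ⟨ε₁, hε₁, hball⟩ := Metric.eventually_nhds_iff.1
    ((hcont sS pS).eventually_lt (hcont sT pT) h)
  refine ⟨ε₁, hε₁, fun ε h0 h1 => hball ?_⟩
  rw [dist_zero_right, Real.norm_eq_abs, abs_of_pos h0]
  exact h1

end BesovTikhonov
end

/-! ### Assembly of the four claims. -/

theorem mainTheorem5 (d : ℕ) (hd : 1 ≤ d) (W : BesovTikhonov.WaveletBasis d)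
    (sD pD sS pS sG pG : ℝ) (hpD : 1 < pD) (hpS : 0 < pS) (hpG : 0 < pG)
    -- the embedding of `B_S` into `B_D`
    (hSD : pS ≤ pD) (hSD' : sD - d / pD < sS - d / pS)
    -- the embedding of `B_G` into the dual of `B_D`
    (hGD : 1 / pD.conjExponent ≤ 1 / pG)
    (hGD' : -sD - d / pD.conjExponent ≤ sG - d / pG)
    (hSG : pS ≤ pG)
    (F : BesovTikhonov.besovSpace W sD pD (zero_lt_one.trans hpD) →ₗ[ℝ] BesovTikhonov.L2 d)
    (hF : BesovTikhonov.IsBounded F)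
    (hFG : (BesovTikhonov.besovSpace W sG pG hpG : Set (BesovTikhonov.Distr d)) ⊆
      BesovTikhonov.adjointRange F) :
    -- `p = min {p_D, p_G}` maximizes `σ` among the allowed penalties
    (∃ ε₀ : ℝ, 0 < ε₀ ∧ ∀ ε : ℝ, 0 < ε → ε < ε₀ →
      BesovTikhonov.AllowedPenalty d sS pS pD sG pG ε
        (BesovTikhonov.optS d sS pS pD sG pG ε) (BesovTikhonov.optP pD pG) ∧
      ∀ sR pR : ℝ, BesovTikhonov.AllowedPenalty d sS pS pD sG pG ε sR pR →
        BesovTikhonov.rateExponent d sR pR ≤ BesovTikhonov.optRate d pD sG pG ε sS pS ∧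
        (BesovTikhonov.rateExponent d sR pR = BesovTikhonov.optRate d pD sG pG ε sS pS →
          sR = BesovTikhonov.optS d sS pS pD sG pG ε ∧ pR = BesovTikhonov.optP pD pG) ∧
        ∀ u : BesovTikhonov.Distr d,
          BesovTikhonov.besovNorm W (BesovTikhonov.rateExponent d sR pR) 2 u ≤
            BesovTikhonov.besovNorm W (BesovTikhonov.optRate d pD sG pG ε sS pS) 2 u) ∧
    -- the case `p_G ≥ p_D`
    (pD ≤ pG → ∀ ε : ℝ, 0 < ε → ∀ pR sR σ : ℝ,
      pR = (pD + pG) / pG →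
      sR = (pD * sS - pG * sG) / (pD + pG) - d * (1 / (pD + pG) * (pD / pS - 1))
        - ε * (pD / pS - 1) →
      σ = (pD * sS - pG * sG) / (pD + pG)
        + d * (1 / 2 - 1 / (pD + pG) * (pG / pG.conjExponent + pD / pS))
        - ε * (pD / pS - 1) →
      pR = BesovTikhonov.optP pD pG ∧ sR = BesovTikhonov.optS d sS pS pD sG pG ε ∧
      σ = BesovTikhonov.optRate d pD sG pG ε sS pS ∧
      ∀ uDag : BesovTikhonov.besovSpace W sD pD (zero_lt_one.trans hpD),
        (uDag : BesovTikhonov.Distr d) ∈ BesovTikhonov.besovSpace W sS pS hpS →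
        BesovTikhonov.ConvergenceRate F uDag sR pR σ) ∧
    -- the case `p_G < p_D`
    (pG < pD → ∀ ε : ℝ, 0 < ε → ∀ pR sR : ℝ,
      pR = 2 →
      sR = 1 / 2 * (sS - d / pS - (sG - d / pG)) - ε * (pG / pS - 1) →
      pR = BesovTikhonov.optP pD pG ∧ sR = BesovTikhonov.optS d sS pS pD sG pG ε ∧
      sR = BesovTikhonov.optRate d pD sG pG ε sS pS ∧
      ∀ uDag : BesovTikhonov.besovSpace W sD pD (zero_lt_one.trans hpD),
        (uDag : BesovTikhonov.Distr d) ∈ BesovTikhonov.besovSpace W sS pS hpS →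
        BesovTikhonov.ConvergenceRate F uDag sR pR sR) ∧
    -- tighter source conditions `B_T ⊂ B_S` give larger `σ`
    (∀ sT pT : ℝ, 0 < pT → pT ≤ pS → sS - d / pS < sT - d / pT →
      (pD ≤ pG →
        BesovTikhonov.optRate d pD sG pG 0 sT pT - BesovTikhonov.optRate d pD sG pG 0 sS pS =
          pD / (pD + pG) * (sT - d / pT - (sS - d / pS))) ∧
      (pG < pD →
        BesovTikhonov.optRate d pD sG pG 0 sT pT - BesovTikhonov.optRate d pD sG pG 0 sS pS =
          1 / 2 * (sT - d / pT - (sS - d / pS))) ∧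
      BesovTikhonov.optRate d pD sG pG 0 sS pS < BesovTikhonov.optRate d pD sG pG 0 sT pT ∧
      ∃ ε₁ : ℝ, 0 < ε₁ ∧ ∀ ε : ℝ, 0 < ε → ε < ε₁ →
        BesovTikhonov.optRate d pD sG pG ε sS pS < BesovTikhonov.optRate d pD sG pG ε sT pT) := by
  have hpD0 : 0 < pD := zero_lt_one.trans hpD
  have hconj : d / pD.conjExponent = d - d / pD := by
    rw [Real.conjExponent]
    have : pD - 1 ≠ 0 := by linarith
    field_simp
  -- Adding the two embedding conditions cancels `s_D` and `d / p_D`, leaving `-d`, which the two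
  -- summands `d / 2` compensate.
  have hAB : 0 < (sS - d / pS + d / 2) + (sG - d / pG + d / 2) := by linarith
  refine ⟨⟨pS * ((sS - d / pS + d / 2) + (sG - d / pG + d / 2)) / (4 * pG), by positivity,
    fun ε _ hε' => ⟨BesovTikhonov.allowedPenalty_opt d sS sG ε hpD0 hpG hSD hSG,
      fun sR pR h => ?_⟩⟩, fun hDG ε hε pR sR σ hpR hsR hσ => ?_,
    fun hDG ε hε pR sR hpR hsR => ?_, fun sT pT hpT _ hST => ?_⟩
  · obtain ⟨h1, h2⟩ := BesovTikhonov.allowedPenalty_rateExponent_le hpS hpG hε' hAB h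
    exact ⟨h1, h2, BesovTikhonov.besovNorm_two_mono W h1⟩
  · have hs : sR = BesovTikhonov.smoothnessBound d sS pS sG pG ε pD := hsR
    have hp' : pR = BesovTikhonov.optP pD pG := by rw [hpR, BesovTikhonov.optP, min_eq_left hDG]
    have hs' : sR = BesovTikhonov.optS d sS pS pD sG pG ε := by
      rw [hs, BesovTikhonov.optS, min_eq_left hDG]
    -- This covers `p_G = 1` too: there `conjExponent` is `1 / 0 = 0`, and both sides are `0`.
    have hG : pG / pG.conjExponent = pG - 1 := by
      rw [Real.conjExponent, div_div_cancel₀ hpG.ne']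
    have hσ' : σ = BesovTikhonov.rateExponent d sR pR := by
      rw [hσ, hG, hs, hpR, BesovTikhonov.rateExponent_smoothnessBound d sS pS sG ε hpG hpD0]
      field_simp
      ring
    refine ⟨hp', hs', ?_, fun uDag hu => ?_⟩
    · rw [hσ', hs', hp', BesovTikhonov.optRate]
    · rw [hσ']
      exact BesovTikhonov.convergenceRate_of_mem F hpS hpG hε.le hFG hSD hDG hpR hs.le uDag hu
  · have hpR' : pR = (pG + pG) / pG := by rw [hpR]; field_simp; norm_num
    have hs : sR = BesovTikhonov.smoothnessBound d sS pS sG pG ε pG := by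
      rw [hsR, BesovTikhonov.smoothnessBound]
      field_simp
      ring
    have hσ : BesovTikhonov.rateExponent d sR pR = sR := by simp [BesovTikhonov.rateExponent, hpR]
    have hp' : pR = BesovTikhonov.optP pD pG := by
      rw [hpR', BesovTikhonov.optP, min_eq_right hDG.le]
    have hs' : sR = BesovTikhonov.optS d sS pS pD sG pG ε := by
      rw [hs, BesovTikhonov.optS, min_eq_right hDG.le]
    refine ⟨hp', hs', ?_, fun uDag hu => ?_⟩
    · rw [BesovTikhonov.optRate, ← hs', ← hp', hσ]
    · have := BesovTikhonov.convergenceRate_of_mem F hpS hpG hε.le hFG hSG le_rfl hpR' hs.le uDag hu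
      rwa [hσ] at this
  · have hsub := BesovTikhonov.optRate_sub d sG sS pS sT pT hpD0 hpG
    have hq : 0 < min pD pG := lt_min hpD0 hpG
    have hlt : BesovTikhonov.optRate d pD sG pG 0 sS pS <
        BesovTikhonov.optRate d pD sG pG 0 sT pT := by
      rw [← sub_pos, hsub]
      exact mul_pos (by positivity) (by linarith)
    refine ⟨fun hDG => ?_, fun hDG => ?_, hlt,
      BesovTikhonov.exists_forall_optRate_lt hpD0 hpG hlt⟩
    · rw [hsub, min_eq_left hDG]
    · rw [hsub, min_eq_right hDG.le]
      congr 1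
      field_simp
      norm_num
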